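/- Let $n\ge 1$. For $k\in\mathbb Z$, $m\in\mathbb Z^n$ let $Q_{k,m}=2^{-k}([0,1)^n+m)$, let $\chi_{k,m}$ be its characteristic function, and let $\mathcal Q$ be the set of all these dyadic cubes; $l(P)$ is the side length of $P\in\mathcal Q$ and $|E|$ the Lebesgue measure of $E$. For a cube $Q$ put $M_{Q,p}(f)=\big(\frac1{|Q|}\int_Q|f(x)|^p\,dx\big)^{1/p}$ if $0<p<\infty$ and $M_{Q,\infty}(f)=\operatorname{ess\,sup}_{x\in Q}|f(x)|$. Let $0<\theta\le q<\infty$ and let $\sigma_1=\theta\,(q/\theta)'$, where $'$ denotes the conjugate exponent; that is, $\sigma_1=\frac{\theta q}{q-\theta}$ if $\theta<q$ and $\sigma_1=\infty$ if $\theta=q$. Let $\{t_k\}_{k\in\mathbb Z}$ be a $q$-admissible weight sequence, i.e. each $t_k$ is a measurable nonnegative function on $\mathbb R^n$ that is positive almost everywhere and satisfies $\int_E t_k(x)^q\,dx<\infty$ for every compact $E\subset\mathbb R^n$. Assume that there is a constant $C_1>0$ such that $$M_{Q,q}(t_k)\,M_{Q,\sigma_1}(t_k^{-1})\le C_1$$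 for all $k\in\mathbb Z$ and all cubes $Q\subset\mathbb R^n$ with sides parallel to the coordinate axes. For a complex sequence $\lambda=\{\lambda_{k,m}\}_{k\in\mathbb Z,m\in\mathbb Z^n}$ and $P\in\mathcal Q$ put $$G_P^q(\lambda,\{t_k\})(x)=\Big(\sum_{k=-\log_2 l(P)}^\infty\ \sum_{h\in\mathbb Z^n}2^{knq/2}\,t_k(x)^q\,|\lambda_{k,h}|^q\,\chi_{k,h}(x)\Big)^{1/q},$$ $$\|\lambda|\dot f_{\infty,q}(\mathbb R^n,\{t_k\})\|=\sup_{P\in\mathcal Q}\Big(\frac1{|P|}\int_P G_P^q(\lambda,\{t_k\})(x)^q\,dx\Big)^{1/q},$$ $$m_P^q(\lambda,\{t_k\})=\inf\Big\{\varepsilon\ge 0:\ \big|\{x\in P: G_P^q(\lambda,\{t_k\})(x)>\varepsilon\}\big|<\tfrac{|P|}4\Big\}\quad(\inf\emptyset=\infty),$$ $$m^q(\lambda,\{t_k\})(x)=\sup_{P\in\mathcal Q}m_P^q(\lambda,\{t_k\})\,\chi_P(x).$$ Then there are constants $c,C>0$, depending only on $n,\theta,q,C_1$, such that for every complex sequence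 $\lambda$ $$c\,\|\lambda|\dot f_{\infty,q}(\mathbb R^n,\{t_k\})\|\le\|m^q(\lambda,\{t_k\})\|_{L_\infty(\mathbb R^n)}\le C\,\|\lambda|\dot f_{\infty,q}(\mathbb R^n,\{t_k\})\|,$$ where the quantities take values in $[0,\infty]$; in particular one of the two is finite if and only if the other is. -/

import Mathlib

open MeasureTheory
open scoped ENNReal NNReal

noncomputable section

/-- The half-open cube with sides parallel to the axes, lower corner `a` and side length `r`. -/
def axisCube {n : ℕ} (a : EuclideanSpace ℝ (Fin n)) (r : ℝ) : Set (EuclideanSpace ℝ (Fin n)) :=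
  {x | ∀ i, a i ≤ x i ∧ x i < a i + r}

/-- The dyadic cube `Q_{k,m} = 2^{-k}([0,1)^n + m)`. -/
def dyadicCube {n : ℕ} (k : ℤ) (m : Fin n → ℤ) : Set (EuclideanSpace ℝ (Fin n)) :=
  {x | ∀ i, (2 : ℝ) ^ (-k) * (m i : ℝ) ≤ x i ∧ x i < (2 : ℝ) ^ (-k) * ((m i : ℝ) + 1)}

/-- `M_{Q,p}(f) = (|Q|⁻¹ ∫_Q |f|^p)^{1/p}` for `0 < p < ∞`, and the essential supremum of `|f|`
over `Q` for `p = ∞`. -/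
def cubeMean {n : ℕ} (Q : Set (EuclideanSpace ℝ (Fin n))) (p : ℝ≥0∞)
    (f : EuclideanSpace ℝ (Fin n) → ℝ) : ℝ≥0∞ :=
  eLpNorm f p ((volume Q)⁻¹ • volume.restrict Q)

/-- A `q`-admissible weight sequence: nonnegative functions, positive almost everywhere, that
belong to `L_q` on every compact set (which includes measurability). -/
structure IsAdmissibleWeightSeq {n : ℕ} (q : ℝ)
    (t : ℤ → EuclideanSpace ℝ (Fin n) → ℝ) : Prop where
  nonneg : ∀ k x, 0 ≤ t k x
  pos_ae : ∀ k, ∀ᵐ x, 0 < t k x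
  memLp_of_isCompact : ∀ k, ∀ S : Set (EuclideanSpace ℝ (Fin n)), IsCompact S →
    MemLp (t k) (ENNReal.ofReal q) (volume.restrict S)

/-- The condition `M_{Q,p}(t_k) M_{Q,σ}(t_j⁻¹) ≤ K 2^{α (k-j)}` for all cubes `Q`, in the diagonal
case `j = k`, where the power of two is `1`. -/
def DiagonalWeightCondition {n : ℕ} (p σ : ℝ≥0∞) (K : ℝ≥0)
    (t : ℤ → EuclideanSpace ℝ (Fin n) → ℝ) : Prop :=
  ∀ (k : ℤ) (a : EuclideanSpace ℝ (Fin n)) (r : ℝ), 0 < r →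
    cubeMean (axisCube a r) p (t k) * cubeMean (axisCube a r) σ (fun x => (t k x)⁻¹) ≤ K

/-- The exponent `σ₁ = θ (q/θ)'`, where `'` is the conjugate exponent; it is `∞` for `θ = q`. -/
def sigmaOne (θ q : ℝ) : ℝ≥0∞ :=
  ENNReal.ofReal θ * ENNReal.conjExponent (ENNReal.ofReal (q / θ))

/-- `∑_{k ≥ j} ∑_h 2^{knq/2} t_k(x)^q |λ_{k,h}|^q χ_{k,h}(x)`. -/
def localSum {n : ℕ} (q : ℝ) (t : ℤ → EuclideanSpace ℝ (Fin n) → ℝ)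
    (lam : ℤ → (Fin n → ℤ) → ℂ) (j : ℤ) (x : EuclideanSpace ℝ (Fin n)) : ℝ≥0∞ :=
  ∑' k : Set.Ici j, ∑' h : Fin n → ℤ,
    (dyadicCube (k : ℤ) h).indicator
      (fun y => ENNReal.ofReal
        ((2 : ℝ) ^ (((k : ℤ) : ℝ) * (n : ℝ) * q / 2) * t k y ^ q * ‖lam k h‖ ^ q)) x

/-- The quasi-norm of `λ` in `ḟ_{∞,q}(ℝⁿ,{t_k})`, with values in `[0,∞]`. The supremum is over
the dyadic cubes `P = Q_{j,m}`, for which `-log₂ l(P) = j`. -/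
def fInftyNorm {n : ℕ} (q : ℝ) (t : ℤ → EuclideanSpace ℝ (Fin n) → ℝ)
    (lam : ℤ → (Fin n → ℤ) → ℂ) : ℝ≥0∞ :=
  ⨆ (j : ℤ) (m : Fin n → ℤ),
    ((volume (dyadicCube j m))⁻¹ * ∫⁻ x in dyadicCube j m, localSum q t lam j x) ^ (1 / q)

/-- The local square function `G_P^q(λ,{t_k})` of a dyadic cube `P` of side length `2^{-j}`. -/
def localG {n : ℕ} (q : ℝ) (t : ℤ → EuclideanSpace ℝ (Fin n) → ℝ)
    (lam : ℤ → (Fin n → ℤ) → ℂ) (j : ℤ) (x : EuclideanSpace ℝ (Fin n)) : ℝ≥0∞ :=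
  localSum q t lam j x ^ (1 / q)

/-- `m_P^q = inf {ε : |{x ∈ P : G_P^q(x) > ε}| < |P|/4}` for `P = Q_{j,m}`, with values in
`[0,∞]`. -/
def quarterLevel {n : ℕ} (q : ℝ) (t : ℤ → EuclideanSpace ℝ (Fin n) → ℝ)
    (lam : ℤ → (Fin n → ℤ) → ℂ) (j : ℤ) (m : Fin n → ℤ) : ℝ≥0∞ :=
  sInf {ε : ℝ≥0∞ |
    volume {x | x ∈ dyadicCube j m ∧ ε < localG q t lam j x} < volume (dyadicCube j m) / 4}

/-- `m^q(x) = sup_P m_P^q χ_P(x)`, the supremum over all dyadic cubes. -/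
def quarterMax {n : ℕ} (q : ℝ) (t : ℤ → EuclideanSpace ℝ (Fin n) → ℝ)
    (lam : ℤ → (Fin n → ℤ) → ℂ) (x : EuclideanSpace ℝ (Fin n)) : ℝ≥0∞ :=
  ⨆ (j : ℤ) (m : Fin n → ℤ), (dyadicCube j m).indicator (fun _ => quarterLevel q t lam j m) x

end

section WeightedCubes

/-! The upper estimate is Chebyshev's inequality on each `P`. For the lower one, take `ε` above
every quarter level and let `E_k` be the set where the local sum started at generation `k` is at
most `ε ^ q`. Each cube of generation `k` has at least half of its measure in `E_k`. Since `1 = t_k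
· t_k⁻¹`, Hölder's inequality and the weight condition show that `E_k` keeps a fixed share of the
integral of `t_k ^ q` over that cube (`lintegral_rpow_cube_le`). Hence the term of each cube may be
cut off to `E_k` at the cost of a constant factor. The sum of the cut-off terms is at most `ε ^ q`
pointwise, by a stopping argument in `k` (`tsum_indicator_localSum_le`); integrating over `P` gives
the bound. -/

variable {n : ℕ}

/-! ### Measure and nesting of dyadic cubes -/

theorem dyadicCube_eq_axisCube (k : ℤ) (m : Fin n → ℤ) :
    dyadicCube k m =
      axisCube (WithLp.toLp 2 fun i => (2 : ℝ) ^ (-k) * (m i : ℝ)) ((2 : ℝ) ^ (-k)) := by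
  ext x
  simp [dyadicCube, axisCube, mul_add]

theorem axisCube_eq_preimage (a : EuclideanSpace ℝ (Fin n)) (r : ℝ) :
    axisCube a r = WithLp.ofLp ⁻¹' Set.univ.pi fun i => Set.Ico (a i) (a i + r) := by
  ext x
  simp [axisCube]

theorem measurableSet_axisCube (a : EuclideanSpace ℝ (Fin n)) (r : ℝ) :
    MeasurableSet (axisCube a r) := by
  rw [axisCube_eq_preimage]
  exact (PiLp.volume_preserving_ofLp (Fin n)).measurable
    (MeasurableSet.univ_pi fun _ => measurableSet_Ico)

theorem volume_axisCube (a : EuclideanSpace ℝ (Fin n)) (r : ℝ) :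
    volume (axisCube a r) = ENNReal.ofReal r ^ n := by
  rw [axisCube_eq_preimage, (PiLp.volume_preserving_ofLp (Fin n)).measure_preimage
    (MeasurableSet.univ_pi fun _ => measurableSet_Ico).nullMeasurableSet, volume_pi_pi]
  simp

theorem measurableSet_dyadicCube (k : ℤ) (m : Fin n → ℤ) : MeasurableSet (dyadicCube k m) := by
  rw [dyadicCube_eq_axisCube]
  exact measurableSet_axisCube _ _

theorem volume_dyadicCube_ne_zero (k : ℤ) (m : Fin n → ℤ) : volume (dyadicCube k m) ≠ 0 := by
  rw [dyadicCube_eq_axisCube, volume_axisCube]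
  refine pow_ne_zero _ ?_
  have : (0 : ℝ) < 2 ^ (-k) := by positivity
  simpa using this

theorem volume_dyadicCube_ne_top (k : ℤ) (m : Fin n → ℤ) : volume (dyadicCube k m) ≠ ∞ := by
  rw [dyadicCube_eq_axisCube, volume_axisCube]
  exact ENNReal.pow_ne_top ENNReal.ofReal_ne_top

theorem dyadic_bounds_of_le {j k m h : ℤ} (hjk : j ≤ k) {x y : ℝ}
    (hxm : (2 : ℝ) ^ (-j) * m ≤ x ∧ x < (2 : ℝ) ^ (-j) * (m + 1))
    (hxh : (2 : ℝ) ^ (-k) * h ≤ x ∧ x < (2 : ℝ) ^ (-k) * (h + 1))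
    (hyh : (2 : ℝ) ^ (-k) * h ≤ y ∧ y < (2 : ℝ) ^ (-k) * (h + 1)) :
    (2 : ℝ) ^ (-j) * m ≤ y ∧ y < (2 : ℝ) ^ (-j) * (m + 1) := by
  obtain ⟨d, rfl⟩ := Int.le.dest hjk
  have hs : (0 : ℝ) < 2 ^ (-(j + (d : ℤ))) := by positivity
  have hj : (2 : ℝ) ^ (-j) = 2 ^ (-(j + (d : ℤ))) * ((2 ^ d : ℤ) : ℝ) := by
    push_cast
    rw [← zpow_natCast, ← zpow_add₀ two_ne_zero]
    congr 1
    ring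
  rw [hj] at hxm ⊢
  generalize (2 : ℝ) ^ (-(j + (d : ℤ))) = s at *
  generalize (2 ^ d : ℤ) = e at *
  have h1 : e * m < h + 1 := by
    have := hxm.1.trans_lt hxh.2
    rw [mul_assoc, mul_lt_mul_iff_right₀ hs] at this
    exact_mod_cast this
  have h2 : h < e * (m + 1) := by
    have := hxh.1.trans_lt hxm.2
    rw [mul_assoc, mul_lt_mul_iff_right₀ hs] at this
    exact_mod_cast this
  -- In units of the finer scale all endpoints are integers, so overlap of the two intervals already
  -- forces inclusion.
  have h1' : (e : ℝ) * m ≤ h := by exact_mod_cast Int.lt_add_one_iff.mp h1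
  have h2' : (h : ℝ) + 1 ≤ e * (m + 1) := by exact_mod_cast h2
  rw [mul_assoc, mul_assoc]
  exact ⟨(mul_le_mul_of_nonneg_left h1' hs.le).trans hyh.1,
    hyh.2.trans_le (mul_le_mul_of_nonneg_left h2' hs.le)⟩

theorem dyadicCube_inter_eq_empty_or_eq {j k : ℤ} (hjk : j ≤ k) (m h : Fin n → ℤ) :
    dyadicCube k h ∩ dyadicCube j m = ∅ ∨ dyadicCube k h ∩ dyadicCube j m = dyadicCube k h := by
  rcases (dyadicCube k h ∩ dyadicCube j m).eq_empty_or_nonempty with he | ⟨x, hxk, hxj⟩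
  · exact .inl he
  · exact .inr (Set.inter_eq_left.2 fun y hy i =>
      dyadic_bounds_of_le hjk (hxj i) (hxk i) (hy i))

/-! ### Hölder's inequality and the weight condition -/

theorem holderTriple_sigmaOne {θ q : ℝ} (hθ : 0 < θ) (hθq : θ ≤ q) :
    ENNReal.HolderTriple (ENNReal.ofReal q) (sigmaOne θ q) (ENNReal.ofReal θ) where
  inv_add_inv_eq_inv := by
    have hq : 0 < q := hθ.trans_le hθq
    have hθ0 : ENNReal.ofReal θ ≠ 0 := by simpa using hθ
    have h1 : 1 ≤ ENNReal.ofReal (q / θ) := by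
      rw [ENNReal.one_le_ofReal]
      exact (one_le_div hθ).2 hθq
    have hc := ENNReal.HolderConjugate.conjExponent h1
    have hconj := hc.inv_add_inv_eq_inv
    rw [sigmaOne, ENNReal.mul_inv (.inl hθ0) (.inl ENNReal.ofReal_ne_top)]
    calc (ENNReal.ofReal q)⁻¹ + (ENNReal.ofReal θ)⁻¹ * (ENNReal.ofReal (q / θ)).conjExponent⁻¹
        = (ENNReal.ofReal θ)⁻¹ *
            ((ENNReal.ofReal (q / θ))⁻¹ + (ENNReal.ofReal (q / θ)).conjExponent⁻¹) := by
          rw [mul_add]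
          congr 1
          rw [← ENNReal.ofReal_inv_of_pos hq, ← ENNReal.ofReal_inv_of_pos hθ,
            ← ENNReal.ofReal_inv_of_pos (div_pos hq hθ), ← ENNReal.ofReal_mul (by positivity)]
          congr 1
          field_simp
      _ = _ := by rw [hconj, inv_one, mul_one]

/-- Hölder's inequality for `1 = t · t⁻¹` on `E`. Multiplying by the full norm of `t` lets `K`
absorb the factor with `t⁻¹`, enlarged from `E` to the whole space. -/
theorem measure_rpow_mul_eLpNorm_le {α : Type*} [MeasurableSpace α] {μ : Measure α}
    {q s θ : ℝ≥0∞} [ENNReal.HolderTriple q s θ] (hθ0 : θ ≠ 0) (hθ : θ ≠ ∞) {t : α → ℝ}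
    (ht : AEStronglyMeasurable t μ) (hpos : ∀ᵐ x ∂μ, 0 < t x) {K : ℝ≥0∞}
    (hK : eLpNorm t q μ * eLpNorm (fun x => (t x)⁻¹) s μ ≤ K) (E : Set α) :
    μ E ^ (1 / θ.toReal) * eLpNorm t q μ ≤ K * eLpNorm t q (μ.restrict E) := by
  have hinv : AEStronglyMeasurable (fun x => (t x)⁻¹) μ :=
    ht.aemeasurable.inv.aestronglyMeasurable
  have hone : (t • fun x => (t x)⁻¹) =ᵐ[μ.restrict E] fun _ => (1 : ℝ) := by
    filter_upwards [ae_restrict_of_ae hpos] with x hx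
    simp [hx.ne']
  have hE : μ E ^ (1 / θ.toReal) = eLpNorm (t • fun x => (t x)⁻¹) θ (μ.restrict E) := by
    rw [eLpNorm_congr_ae hone, eLpNorm_const' _ hθ0 hθ]
    simp
  calc μ E ^ (1 / θ.toReal) * eLpNorm t q μ
      ≤ (eLpNorm t q (μ.restrict E) * eLpNorm (fun x => (t x)⁻¹) s (μ.restrict E)) *
          eLpNorm t q μ := by
        rw [hE]
        gcongr
        exact eLpNorm_smul_le_mul_eLpNorm hinv.restrict ht.restrict
    _ ≤ (eLpNorm t q (μ.restrict E) * eLpNorm (fun x => (t x)⁻¹) s μ) * eLpNorm t q μ := by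
        gcongr
        exact Measure.restrict_le_self
    _ = (eLpNorm t q μ * eLpNorm (fun x => (t x)⁻¹) s μ) * eLpNorm t q (μ.restrict E) := by ring
    _ ≤ _ := by gcongr

variable {θ q : ℝ} {K : ℝ≥0} {t : ℤ → EuclideanSpace ℝ (Fin n) → ℝ}

theorem IsAdmissibleWeightSeq.aestronglyMeasurable (ht : IsAdmissibleWeightSeq q t) (k : ℤ) :
    AEStronglyMeasurable (t k) volume := by
  rw [← Measure.restrict_univ (μ := volume), ← Metric.iUnion_closedBall_nat (0 : EuclideanSpace ℝ (Fin n)),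
    aestronglyMeasurable_iUnion_iff]
  exact fun i => (ht.memLp_of_isCompact k _ (isCompact_closedBall _ _)).aestronglyMeasurable

/-- An `A_∞`-type property of `t_k ^ q`. Under normalized measure on the cube, `E` has mass at least
`1/2`, whence the factor `2 ^ (1 / θ)`. -/
theorem lintegral_rpow_cube_le (hθ : 0 < θ) (hθq : θ ≤ q) (ht : IsAdmissibleWeightSeq q t)
    (hK : DiagonalWeightCondition (ENNReal.ofReal q) (sigmaOne θ q) K t) (k : ℤ)
    (m : Fin n → ℤ) {E : Set (EuclideanSpace ℝ (Fin n))}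
    (hE : volume (dyadicCube k m) ≤ 2 * volume (E ∩ dyadicCube k m)) :
    ∫⁻ x in dyadicCube k m, ‖t k x‖ₑ ^ q ≤
      ((K : ℝ≥0∞) * 2 ^ (1 / θ)) ^ q * ∫⁻ x in E ∩ dyadicCube k m, ‖t k x‖ₑ ^ q := by
  have hq : 0 < q := hθ.trans_le hθq
  have hV0 := volume_dyadicCube_ne_zero k m
  have hVt := volume_dyadicCube_ne_top k m
  set Q := dyadicCube k m
  set V := volume Q
  have hmeas : MeasurableSet Q := measurableSet_dyadicCube k m
  have hQK : eLpNorm (t k) (ENNReal.ofReal q) (V⁻¹ • volume.restrict Q) *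
      eLpNorm (fun x => (t k x)⁻¹) (sigmaOne θ q) (V⁻¹ • volume.restrict Q) ≤ K := by
    have := hK k (WithLp.toLp 2 fun i => (2 : ℝ) ^ (-k) * (m i : ℝ)) ((2 : ℝ) ^ (-k))
      (by positivity)
    rwa [← dyadicCube_eq_axisCube] at this
  have := holderTriple_sigmaOne hθ hθq
  have hmain := measure_rpow_mul_eLpNorm_le (θ := ENNReal.ofReal θ) (by simpa using hθ)
    ENNReal.ofReal_ne_top
    ((ht.aestronglyMeasurable k).restrict.smul_measure V⁻¹)
    (Measure.ae_smul_measure (ae_restrict_of_ae (ht.pos_ae k)) V⁻¹) hQK E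
  have hhalf : 2⁻¹ ≤ (V⁻¹ • volume.restrict Q) E := by
    rw [Measure.smul_apply, Measure.restrict_apply' hmeas, smul_eq_mul]
    calc (2 : ℝ≥0∞)⁻¹ = V⁻¹ * (2⁻¹ * V) := by
          rw [mul_left_comm, ENNReal.inv_mul_cancel hV0 hVt, mul_one]
      _ ≤ V⁻¹ * (2⁻¹ * (2 * volume (E ∩ Q))) := by gcongr
      _ = V⁻¹ * volume (E ∩ Q) := by
          rw [← mul_assoc 2⁻¹, ENNReal.inv_mul_cancel two_ne_zero ENNReal.ofNat_ne_top, one_mul]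
  rw [ENNReal.toReal_ofReal hθ.le] at hmain
  have h2 : eLpNorm (t k) (ENNReal.ofReal q) (V⁻¹ • volume.restrict Q) ≤
      (K * 2 ^ (1 / θ)) *
        eLpNorm (t k) (ENNReal.ofReal q) ((V⁻¹ • volume.restrict Q).restrict E) := by
    have h22 : (2 : ℝ≥0∞) ^ (1 / θ) * 2⁻¹ ^ (1 / θ) = 1 := by
      rw [← ENNReal.mul_rpow_of_nonneg _ _ (by positivity),
        ENNReal.mul_inv_cancel two_ne_zero ENNReal.ofNat_ne_top, ENNReal.one_rpow]
    calc eLpNorm (t k) (ENNReal.ofReal q) (V⁻¹ • volume.restrict Q)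
        = 2 ^ (1 / θ) *
          (2⁻¹ ^ (1 / θ) * eLpNorm (t k) (ENNReal.ofReal q) (V⁻¹ • volume.restrict Q)) := by
          rw [← mul_assoc, h22, one_mul]
      _ ≤ 2 ^ (1 / θ) * (K *
          eLpNorm (t k) (ENNReal.ofReal q) ((V⁻¹ • volume.restrict Q).restrict E)) := by
          refine mul_le_mul_right (le_trans ?_ hmain) _
          gcongr
      _ = _ := by ring
  have hpow : ∀ μ : Measure (EuclideanSpace ℝ (Fin n)),
      eLpNorm (t k) (ENNReal.ofReal q) μ ^ q = ∫⁻ x, ‖t k x‖ₑ ^ q ∂μ := by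
    intro μ
    rw [eLpNorm_eq_lintegral_rpow_enorm_toReal (by simpa using hq) ENNReal.ofReal_ne_top,
      ENNReal.toReal_ofReal hq.le, ← ENNReal.rpow_mul, one_div_mul_cancel hq.ne',
      ENNReal.rpow_one]
  have h3 := ENNReal.rpow_le_rpow h2 hq.le
  rw [ENNReal.mul_rpow_of_nonneg _ _ hq.le, hpow, hpow, Measure.restrict_smul,
    Measure.restrict_restrict' hmeas, lintegral_smul_measure, lintegral_smul_measure,
    smul_eq_mul, smul_eq_mul, mul_left_comm] at h3
  exact (ENNReal.mul_le_mul_iff_right (ENNReal.inv_ne_zero.2 hVt) (ENNReal.inv_ne_top.2 hV0)).1 h3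

/-- The contribution of the cube `Q_{k,h}` to `localSum`. -/
noncomputable def cubeTerm (q : ℝ) (t : ℤ → EuclideanSpace ℝ (Fin n) → ℝ) (lam : ℤ → (Fin n → ℤ) → ℂ)
    (k : ℤ) (h : Fin n → ℤ) : EuclideanSpace ℝ (Fin n) → ℝ≥0∞ :=
  (dyadicCube k h).indicator fun y =>
    ENNReal.ofReal ((2 : ℝ) ^ ((k : ℝ) * (n : ℝ) * q / 2) * t k y ^ q * ‖lam k h‖ ^ q)

/-! ### Local sums and their truncation -/

variable {lam : ℤ → (Fin n → ℤ) → ℂ}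

theorem localSum_eq_tsum_cubeTerm (j : ℤ) (x : EuclideanSpace ℝ (Fin n)) :
    localSum q t lam j x = ∑' k : Set.Ici j, ∑' h, cubeTerm q t lam k h x := rfl

theorem cubeTerm_eq (hq : 0 < q) (ht : IsAdmissibleWeightSeq q t) (k : ℤ) (h : Fin n → ℤ) :
    cubeTerm q t lam k h = (dyadicCube k h).indicator fun y =>
      ENNReal.ofReal ((2 : ℝ) ^ ((k : ℝ) * (n : ℝ) * q / 2) * ‖lam k h‖ ^ q) *
        ‖t k y‖ₑ ^ q := by
  unfold cubeTerm
  congr 1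
  ext y
  rw [Real.enorm_of_nonneg (ht.nonneg k y), ENNReal.ofReal_rpow_of_nonneg (ht.nonneg k y) hq.le,
    ← ENNReal.ofReal_mul (by positivity)]
  congr 1
  ring

theorem aemeasurable_cubeTerm (hq : 0 < q) (ht : IsAdmissibleWeightSeq q t) (k : ℤ)
    (h : Fin n → ℤ) : AEMeasurable (cubeTerm q t lam k h) volume := by
  rw [cubeTerm_eq hq ht]
  exact (((ht.aestronglyMeasurable k).enorm.pow_const q).const_mul _).indicator
    (measurableSet_dyadicCube k h)

theorem aemeasurable_localSum (hq : 0 < q) (ht : IsAdmissibleWeightSeq q t) (j : ℤ) :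
    AEMeasurable (localSum q t lam j) volume := by
  change AEMeasurable (fun x => ∑' k : Set.Ici j, ∑' h, cubeTerm q t lam k h x) volume
  exact AEMeasurable.tsum fun k => AEMeasurable.tsum fun h =>
    aemeasurable_cubeTerm hq ht k h

/-- Removing small pieces of the cubes of generation `k` costs a bounded factor in the integral of
`cubeTerm` over a coarser cube. -/
theorem lintegral_cubeTerm_le (hθ : 0 < θ) (hθq : θ ≤ q) (ht : IsAdmissibleWeightSeq q t)
    (hK : DiagonalWeightCondition (ENNReal.ofReal q) (sigmaOne θ q) K t) {j k : ℤ} (hjk : j ≤ k)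
    (m h : Fin n → ℤ) {E : Set (EuclideanSpace ℝ (Fin n))} (hEm : NullMeasurableSet E volume)
    (hE : volume (dyadicCube k h) ≤ 2 * volume (E ∩ dyadicCube k h)) :
    ∫⁻ x in dyadicCube j m, cubeTerm q t lam k h x ≤
      ((K : ℝ≥0∞) * 2 ^ (1 / θ)) ^ q *
        ∫⁻ x in dyadicCube j m, E.indicator (cubeTerm q t lam k h) x := by
  have hq : 0 < q := hθ.trans_le hθq
  have hQ := measurableSet_dyadicCube k h
  rw [cubeTerm_eq hq ht]
  rw [lintegral_indicator hQ, Measure.restrict_restrict hQ,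
    lintegral_indicator₀ (hEm.mono_ac Measure.restrict_le_self.absolutelyContinuous),
    Measure.restrict_restrict₀ (hEm.mono_ac Measure.restrict_le_self.absolutelyContinuous),
    lintegral_indicator hQ, Measure.restrict_restrict hQ, Set.inter_left_comm]
  -- The finer cube misses the coarser one or lies inside it, so only integrals over the full finer
  -- cube remain.
  rcases dyadicCube_inter_eq_empty_or_eq hjk m h with he | he
  · simp [he]
  · rw [he, lintegral_const_mul' _ _ ENNReal.ofReal_ne_top,
      lintegral_const_mul' _ _ ENNReal.ofReal_ne_top, mul_left_comm]
    gcongr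
    exact lintegral_rpow_cube_le hθ hθq ht hK k h hE

/-- Stopping argument: if `k₀` is the least `k ≥ j` whose local sum at `x` is at most `b`, only
generations `k ≥ k₀` survive, and together they are bounded by the local sum started at `k₀`. If no
such `k` exists, every term vanishes. -/
theorem tsum_indicator_localSum_le (j : ℤ) (b : ℝ≥0∞) (x : EuclideanSpace ℝ (Fin n)) :
    ∑' k : Set.Ici j, ∑' h,
      {y | localSum q t lam k y ≤ b}.indicator (cubeTerm q t lam k h) x ≤ b := by
  by_cases hex : ∃ k, j ≤ k ∧ localSum q t lam k x ≤ b
  · obtain ⟨k₀, ⟨hj, hk₀⟩, hmin⟩ := Int.exists_least_of_bdd (P := fun k =>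
      j ≤ k ∧ localSum q t lam k x ≤ b) ⟨j, fun _ hz => hz.1⟩ hex
    refine le_trans ?_ hk₀
    rw [localSum_eq_tsum_cubeTerm]
    rw [tsum_subtype (Set.Ici j) fun k => ∑' h,
      {y | localSum q t lam k y ≤ b}.indicator (cubeTerm q t lam k h) x,
      tsum_subtype (Set.Ici k₀) fun k => ∑' h, cubeTerm q t lam k h x]
    refine ENNReal.tsum_le_tsum fun k => ?_
    by_cases hk : j ≤ k ∧ localSum q t lam k x ≤ b
    · rw [Set.indicator_of_mem (Set.mem_Ici.2 hk.1),
        Set.indicator_of_mem (Set.mem_Ici.2 (hmin k hk))]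
      exact ENNReal.tsum_le_tsum fun h => Set.indicator_le_self _ (cubeTerm q t lam k h) x
    · refine le_of_eq_of_le ?_ zero_le
      by_cases hjk : j ≤ k
      · have : x ∉ {y | localSum q t lam k y ≤ b} := fun hx => hk ⟨hjk, hx⟩
        simp [Set.indicator_of_notMem this]
      · exact Set.indicator_of_notMem (s := Set.Ici j) hjk _
  · refine le_of_eq_of_le (ENNReal.tsum_eq_zero.2 fun k => ENNReal.tsum_eq_zero.2 fun h => ?_)
      zero_le
    exact Set.indicator_of_notMem (s := {y | localSum q t lam k y ≤ b})
      (fun hx => hex ⟨k, k.2, hx⟩) (cubeTerm q t lam k h)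

/-! ### Quarter levels and the two estimates -/

/-- A dyadic cube has positive measure, so the essential supremum cannot overlook its level. -/
theorem quarterLevel_le_essSup (j : ℤ) (m : Fin n → ℤ) :
    quarterLevel q t lam j m ≤ essSup (quarterMax q t lam) volume := by
  by_contra hlt
  refine volume_dyadicCube_ne_zero j m (measure_mono_null (fun x hx (hle : quarterMax q t lam x ≤ _) => hlt ?_)
    (ae_iff.1 (ENNReal.ae_le_essSup (μ := volume) (quarterMax q t lam))))
  refine le_trans ?_ hle
  refine le_trans ?_ (le_iSup₂ (f := fun j m =>
    (dyadicCube j m).indicator (fun _ => quarterLevel q t lam j m) x) j m)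
  rw [Set.indicator_of_mem hx]

theorem volume_le_of_quarterLevel_lt (hq : 0 < q) {j : ℤ} {m : Fin n → ℤ} {ε : ℝ≥0∞}
    (hε : quarterLevel q t lam j m < ε) :
    volume (dyadicCube j m) ≤
      2 * volume ({y | localSum q t lam j y ≤ ε ^ q} ∩ dyadicCube j m) := by
  obtain ⟨δ, hδ, hδε⟩ := sInf_lt_iff.1 hε
  have hV := volume_dyadicCube_ne_top j m
  set V := volume (dyadicCube j m)
  set E := {y | localSum q t lam j y ≤ ε ^ q}
  have hcover : dyadicCube j m ⊆ (E ∩ dyadicCube j m) ∪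
      {x | x ∈ dyadicCube j m ∧ δ < localG q t lam j x} := by
    intro x hx
    by_cases hxδ : δ < localG q t lam j x
    · exact .inr ⟨hx, hxδ⟩
    · refine .inl ⟨?_, hx⟩
      have h := ENNReal.rpow_le_rpow ((not_lt.1 hxδ).trans hδε.le) hq.le
      rwa [localG, ← ENNReal.rpow_mul, one_div_mul_cancel hq.ne', ENNReal.rpow_one] at h
  have h1 : V ≤ volume (E ∩ dyadicCube j m) + V / 4 :=
    ((measure_mono hcover).trans (measure_union_le _ _)).trans (by gcongr; exact le_of_lt hδ)
  -- Three quarters of the cube remain; one half suffices below.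
  have h2 : V / 4 ≤ V / 2 := by gcongr; norm_num
  have h3 : V / 2 ≤ volume (E ∩ dyadicCube j m) := by
    have h4 : V / 2 + V / 2 ≤ volume (E ∩ dyadicCube j m) + V / 2 := by
      rw [ENNReal.add_halves]
      exact h1.trans (by gcongr)
    exact (ENNReal.add_le_add_iff_right (ENNReal.div_ne_top hV two_ne_zero)).1 h4
  calc V = 2 * (V / 2) := by rw [ENNReal.mul_div_cancel two_ne_zero ENNReal.ofNat_ne_top]
    _ ≤ _ := by gcongr

/-- Each cube's term is exchanged for its truncation under the integral; the truncated terms are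
then summed pointwise. -/
theorem lintegral_localSum_le (hθ : 0 < θ) (hθq : θ ≤ q) (ht : IsAdmissibleWeightSeq q t)
    (hK : DiagonalWeightCondition (ENNReal.ofReal q) (sigmaOne θ q) K t) {ε : ℝ≥0∞}
    (hε : ∀ j m, quarterLevel q t lam j m < ε) (j : ℤ) (m : Fin n → ℤ) :
    ∫⁻ x in dyadicCube j m, localSum q t lam j x ≤
      ((K : ℝ≥0∞) * 2 ^ (1 / θ)) ^ q * (ε ^ q * volume (dyadicCube j m)) := by
  have hq : 0 < q := hθ.trans_le hθq
  have hE : ∀ k, NullMeasurableSet {y | localSum q t lam k y ≤ ε ^ q} volume := fun k =>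
    (aemeasurable_localSum hq ht k).nullMeasurable measurableSet_Iic
  have hterm : ∀ k h, AEMeasurable (cubeTerm q t lam k h) (volume.restrict (dyadicCube j m)) :=
    fun k h => (aemeasurable_cubeTerm hq ht k h).restrict
  have hind : ∀ k h, AEMeasurable ({y | localSum q t lam k y ≤ ε ^ q}.indicator
      (cubeTerm q t lam k h)) (volume.restrict (dyadicCube j m)) :=
    fun k h => ((aemeasurable_cubeTerm hq ht k h).indicator₀ (hE k)).restrict
  simp_rw [localSum_eq_tsum_cubeTerm]
  rw [lintegral_tsum fun k : Set.Ici j => AEMeasurable.tsum fun h => hterm k h]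
  simp_rw [lintegral_tsum fun h => hterm _ h]
  calc ∑' k : Set.Ici j, ∑' h, ∫⁻ x in dyadicCube j m, cubeTerm q t lam k h x
      ≤ ∑' k : Set.Ici j, ∑' h, ((K : ℝ≥0∞) * 2 ^ (1 / θ)) ^ q * ∫⁻ x in dyadicCube j m,
          {y | localSum q t lam k y ≤ ε ^ q}.indicator (cubeTerm q t lam k h) x :=
        ENNReal.tsum_le_tsum fun k => ENNReal.tsum_le_tsum fun h =>
          lintegral_cubeTerm_le hθ hθq ht hK k.2 m h (hE k)
            (volume_le_of_quarterLevel_lt hq (hε k h))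
    _ = ((K : ℝ≥0∞) * 2 ^ (1 / θ)) ^ q * ∫⁻ x in dyadicCube j m, ∑' k : Set.Ici j, ∑' h,
          {y | localSum q t lam k y ≤ ε ^ q}.indicator (cubeTerm q t lam k h) x := by
        rw [lintegral_tsum fun k : Set.Ici j => AEMeasurable.tsum fun h => hind k h]
        simp_rw [lintegral_tsum fun h => hind _ h, ENNReal.tsum_mul_left]
    _ ≤ ((K : ℝ≥0∞) * 2 ^ (1 / θ)) ^ q * ∫⁻ _ in dyadicCube j m, ε ^ q := by
        gcongr with x
        exact tsum_indicator_localSum_le j (ε ^ q) x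
    _ = _ := by rw [setLIntegral_const]

theorem fInftyNorm_le (hθ : 0 < θ) (hθq : θ ≤ q) (ht : IsAdmissibleWeightSeq q t)
    (hK : DiagonalWeightCondition (ENNReal.ofReal q) (sigmaOne θ q) K t) {ε : ℝ≥0∞}
    (hε : ∀ j m, quarterLevel q t lam j m < ε) :
    fInftyNorm q t lam ≤ (K * 2 ^ (1 / θ)) * ε := by
  have hq : 0 < q := hθ.trans_le hθq
  refine iSup₂_le fun j m => ?_
  rw [one_div, ENNReal.rpow_inv_le_iff hq, ENNReal.mul_rpow_of_nonneg _ ε hq.le]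
  calc (volume (dyadicCube j m))⁻¹ * ∫⁻ x in dyadicCube j m, localSum q t lam j x
      ≤ (volume (dyadicCube j m))⁻¹ *
          (((K : ℝ≥0∞) * 2 ^ (1 / θ)) ^ q * (ε ^ q * volume (dyadicCube j m))) := by
        gcongr
        exact lintegral_localSum_le hθ hθq ht hK hε j m
    _ = ((K : ℝ≥0∞) * 2 ^ (1 / θ)) ^ q * ε ^ q *
          ((volume (dyadicCube j m))⁻¹ * volume (dyadicCube j m)) := by ring
    _ = _ := by rw [ENNReal.inv_mul_cancel (volume_dyadicCube_ne_zero j m)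
                  (volume_dyadicCube_ne_top j m), mul_one]

theorem quarterLevel_le (hq : 0 < q) (ht : IsAdmissibleWeightSeq q t) (j : ℤ)
    (m : Fin n → ℤ) :
    quarterLevel q t lam j m ≤ 4 ^ (1 / q) * fInftyNorm q t lam := by
  have hV0 := volume_dyadicCube_ne_zero j m
  have hVt := volume_dyadicCube_ne_top j m
  -- Any `ε` above the right-hand side is an admissible level: otherwise Chebyshev's inequality on a
  -- set of measure at least a quarter of the cube bounds `ε` by that side.
  refine le_of_forall_gt_imp_ge_of_dense fun ε hε => sInf_le ?_
  by_contra hvol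
  rw [Set.mem_ofPred_eq, not_lt, ENNReal.div_le_iff (by simp) (by simp)] at hvol
  refine hε.not_ge ((ENNReal.rpow_le_rpow_iff hq).1 ?_)
  rw [ENNReal.mul_rpow_of_nonneg _ _ hq.le, ← ENNReal.rpow_mul, one_div_mul_cancel hq.ne',
    ENNReal.rpow_one, ← ENNReal.mul_le_mul_iff_left hV0 hVt]
  have hN : ∫⁻ x in dyadicCube j m, localSum q t lam j x ≤
      fInftyNorm q t lam ^ q * volume (dyadicCube j m) := by
    rw [← ENNReal.div_le_iff hV0 hVt, div_eq_mul_inv, mul_comm,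
      ← ENNReal.rpow_inv_le_iff hq, ← one_div q]
    exact le_iSup₂ (f := fun j m => ((volume (dyadicCube j m))⁻¹ *
      ∫⁻ x in dyadicCube j m, localSum q t lam j x) ^ (1 / q)) j m
  have hsub : {x | x ∈ dyadicCube j m ∧ ε < localG q t lam j x} ⊆
      {x | ε ^ q ≤ localSum q t lam j x} ∩ dyadicCube j m := fun x hx => by
    refine ⟨?_, hx.1⟩
    have h := ENNReal.rpow_le_rpow hx.2.le hq.le
    rwa [localG, ← ENNReal.rpow_mul, one_div_mul_cancel hq.ne', ENNReal.rpow_one] at h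
  calc ε ^ q * volume (dyadicCube j m)
      ≤ ε ^ q * (volume ({x | ε ^ q ≤ localSum q t lam j x} ∩ dyadicCube j m) * 4) := by
        gcongr
        exact hvol.trans (by gcongr)
    _ = 4 * (ε ^ q * volume.restrict (dyadicCube j m) {x | ε ^ q ≤ localSum q t lam j x}) := by
        rw [Measure.restrict_apply' (measurableSet_dyadicCube j m)]
        ring
    _ ≤ 4 * (fInftyNorm q t lam ^ q * volume (dyadicCube j m)) := by
        refine mul_le_mul_right ?_ _
        exact (mul_meas_ge_le_lintegral₀ (aemeasurable_localSum hq ht j).restrict _).trans hN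
    _ = _ := by ring

theorem essSup_quarterMax_le (hq : 0 < q) (ht : IsAdmissibleWeightSeq q t) :
    essSup (quarterMax q t lam) volume ≤ 4 ^ (1 / q) * fInftyNorm q t lam :=
  essSup_le_of_ae_le _ (.of_forall fun _ => iSup₂_le fun j m =>
    Set.indicator_le' (fun _ _ => quarterLevel_le hq ht j m) (fun _ _ => zero_le) _)

end WeightedCubes

theorem mainTheorem7 (n : ℕ) (θ q : ℝ) (hθ : 0 < θ) (hθq : θ ≤ q) (K : ℝ≥0) :
    ∃ c C : ℝ≥0, 0 < c ∧ 0 < C ∧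
      ∀ t : ℤ → EuclideanSpace ℝ (Fin n) → ℝ,
        IsAdmissibleWeightSeq q t →
        DiagonalWeightCondition (ENNReal.ofReal q) (sigmaOne θ q) K t →
        ∀ lam : ℤ → (Fin n → ℤ) → ℂ,
          (c : ℝ≥0∞) * fInftyNorm q t lam ≤ essSup (quarterMax q t lam) volume ∧
          essSup (quarterMax q t lam) volume ≤ (C : ℝ≥0∞) * fInftyNorm q t lam := by
  have hq : 0 < q := hθ.trans_le hθq
  -- `K + 1` replaces `K` so that the inverted constant is nonzero even for `K = 0`.
  refine ⟨((K + 1) * 2 ^ (1 / θ))⁻¹, 4 ^ (1 / q), by positivity, by positivity,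
    fun t ht hK lam => ⟨?_, ?_⟩⟩
  · refine le_of_forall_gt_imp_ge_of_dense fun ε hε => ?_
    have hN := fInftyNorm_le hθ hθq ht hK (lam := lam)
      fun j m => (quarterLevel_le_essSup j m).trans_lt hε
    have hD : ((K + 1) * 2 ^ (1 / θ) : ℝ≥0) ≠ 0 := by positivity
    rw [ENNReal.coe_inv hD, mul_comm, ← div_eq_mul_inv]
    refine ENNReal.div_le_of_le_mul (hN.trans ?_)
    rw [mul_comm ε, ENNReal.coe_mul, ENNReal.coe_rpow_of_nonneg _ (by positivity)]
    push_cast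
    gcongr
    exact le_self_add
  · rw [ENNReal.coe_rpow_of_nonneg _ (by positivity)]
    exact essSup_quarterMax_le hq ht
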